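/- Let $\langle\cdot,\cdot\rangle$ denote the standard pairings on $\mathbb{N}$ and on Baire space $\mathbb{N}^{\mathbb{N}}$. A represented space is a set $X$ with a partial surjection $\delta:\subseteq\mathbb{N}^{\mathbb{N}}\to X$. For a multi-valued partial function $f:\subseteq X\rightrightarrows Y$ between represented spaces, a partial function $F:\subseteq\mathbb{N}^{\mathbb{N}}\to\mathbb{N}^{\mathbb{N}}$ is a realizer of $f$, written $F\vdash f$, if $\delta_Y(F(p))\in f(\delta_X(p))$ for all $p\in\mathrm{dom}(f\circ\delta_X)$. Write $f\le_{\mathrm W}g$ (respectively $f\le_{\mathrm{sW}}g$) if there are computable $K,H:\subseteq\mathbb{N}^{\mathbb{N}}\to\mathbb{N}^{\mathbb{N}}$ such that $K\circ\langle\mathrm{id},G\circ H\rangle\vdash f$ (respectively $K\circ G\circ H\vdash f$) for all $G\vdash g$. Let $\mathsf C_{\mathbb N\times 2^{\mathbb N}}:\subseteq\mathcal A_-(\mathbb N\times 2^{\mathbb N})\rightrightarrows\mathbb N\times 2^{\mathbb N}$, $A\mapsto A$, be closed choice on $\mathbb N\times 2^{\mathbb N}$ ("locally compact choice"): its domain is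 the set of non-empty closed subsets, where a closed set $A$ is represented by negative information, i.e. by a name of the characteristic function of its complement as a map into Sierpiński space, in the function space representation. Let $(U_n)_{n\in\mathbb N}$ be a standard enumeration of the c.e. open subsets of $\mathbb N^{\mathbb N}$, let $J:\mathbb N^{\mathbb N}\to\mathbb N^{\mathbb N}$ be the Turing jump operator, $J(p)(n)=1$ if $p\in U_n$ and $J(p)(n)=0$ otherwise, let $\lim:\subseteq\mathbb N^{\mathbb N}\to\mathbb N^{\mathbb N}$, $\langle q_0,q_1,\dots\rangle\mapsto\lim_{i\to\infty}q_i$, and let $\mathsf L=J^{-1}\circ\lim:\subseteq\mathbb N^{\mathbb N}\to\mathbb N^{\mathbb N}$. Then $$\mathsf C_{\mathbb N\times 2^{\mathbb N}}\le_{\mathrm{sW}}\mathsf L\qquad\text{and}\qquad \mathsf L\not\le_{\mathrm W}\mathsf C_{\mathbb N\times 2^{\mathbb N}}.$$ In particular $\mathsf C_{\mathbb N\times 2^{\mathbb N}}\le_{\mathrm W}\mathsf L$ and $\mathsf L\not\le_{\mathrm W}\mathsf C_{\mathbb N\times 2^{\mathbb N}}$, so $\mathsf L$ lies strictly above locally compact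 choice in the Weihrauch order. -/

import Mathlib

open Filter Topology

namespace Weihrauch

/-! ### Baire space and its computable partial functions -/

/-- Baire space `ℕ^ℕ`, with the product of the discrete topologies. -/
abbrev Baire : Type := ℕ → ℕ

/-- The length `k` prefix of `p`, coded as a natural number. -/
def prefixCode (p : Baire) (k : ℕ) : ℕ :=
  Encodable.encode ((List.range k).map p)

/-- The computation with program `α` and oracle `p` on argument `n`: it presents longer and longer
prefixes of `p` to `α` together with `n`; the answer `0` means "read on", the first answer of the
form `v + 1` terminates the computation with value `v`. -/
def evalAt (α p : Baire) (n : ℕ) : Part ℕ :=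
  Nat.rfindOpt fun k => Nat.ppred (α (Nat.pair n (prefixCode p k)))

/-- The partial function `η_α :⊆ ℕ^ℕ → ℕ^ℕ` given by the program (associate) `α`; it is defined at
`p` if all the values `η_α(p)(n)` are defined. -/
def eta (α : Baire) : Baire →. Baire := fun p =>
  ⟨∀ n, (evalAt α p n).Dom, fun h n => (evalAt α p n).get (h n)⟩

/-- A partial function on Baire space is computable if it is computed, on its domain, by some
computable program. -/
def IsComputable (F : Baire →. Baire) : Prop :=
  ∃ α : Baire, Computable α ∧ ∀ p, ∀ q ∈ F p, q ∈ eta α p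

/-- A partial function on Baire space is continuous if it is so for the subspace topology on its
domain. -/
def IsContinuous (F : Baire →. Baire) : Prop :=
  Continuous F.asSubtype

/-- The bijective pairing `⟨p, q⟩ = p(0) q(0) p(1) q(1) …` of Baire space. -/
def pair (p q : Baire) : Baire := fun n => if n % 2 = 0 then p (n / 2) else q (n / 2)

/-! ### Represented spaces, realizers, reducibility -/

/-- A representation of `X`, that is, a partial surjective single-valued map from Baire space onto
`X`, given through its graph: `δ.Names p x` means that `p ∈ dom δ` and `δ(p) = x`. -/
structure Representation (X : Type) where
  /-- `p` is a name of `x`. -/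
  Names : Baire → X → Prop
  unique : ∀ p x y, Names p x → Names p y → x = y
  surj : ∀ x, ∃ p, Names p x

/-- A multi-valued partial function `f :⊆ X ⇉ Y` between represented spaces; its domain is the set
of those `x` with `f x` non-empty. -/
structure Problem where
  {X : Type}
  {Y : Type}
  repX : Representation X
  repY : Representation Y
  map : X → Set Y

/-- `F ⊢ f`: the partial function `F` is a realizer of `f`. -/
def Realizes (F : Baire →. Baire) (f : Problem) : Prop :=
  ∀ p x, f.repX.Names p x → (f.map x).Nonempty → ∃ q ∈ F p, ∃ y ∈ f.map x, f.repY.Names q y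

/-- Weihrauch reducibility `f ≤_W g`: there are computable `K`, `H` such that
`K ∘ ⟨id, G ∘ H⟩ ⊢ f` for all `G ⊢ g`. -/
def Reducible (f g : Problem) : Prop :=
  ∃ K H : Baire →. Baire, IsComputable K ∧ IsComputable H ∧
    ∀ G : Baire →. Baire, Realizes G g →
      Realizes (fun p => ((H p).bind G).bind fun r => K (pair p r)) f

/-- Strong Weihrauch reducibility `f ≤_sW g`: there are computable `K`, `H` such that
`K ∘ G ∘ H ⊢ f` for all `G ⊢ g`. -/
def StrongReducible (f g : Problem) : Prop :=
  ∃ K H : Baire →. Baire, IsComputable K ∧ IsComputable H ∧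
    ∀ G : Baire →. Baire, Realizes G g →
      Realizes (fun p => ((H p).bind G).bind K) f

/-! ### Some represented spaces -/

/-- Baire space, represented by the identity. -/
def baireRep : Representation Baire where
  Names p x := p = x
  unique _ _ _ h h' := h.symm.trans h'
  surj x := ⟨x, rfl⟩

/-- The natural numbers, with `δ_ℕ(p) = p(0)`. -/
def natRep : Representation ℕ where
  Names p n := p 0 = n
  unique _ _ _ h h' := h.symm.trans h'
  surj n := ⟨fun _ => n, rfl⟩

/-- Cantor space `{0,1}^ℕ`, represented by the restriction of the identity of Baire space to the
binary sequences. -/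
def cantorRep : Representation (ℕ → Bool) where
  Names p x := p = fun n => (x n).toNat
  unique p x y h h' := by
    funext n
    have := congrFun (h.symm.trans h') n
    cases hx : x n <;> cases hy : y n <;> simp_all
  surj x := ⟨_, rfl⟩

/-- Sierpiński space, as the type of propositions with `1 = True`:
`δ(p) = 1` if and only if `p(n) = 0` for some `n`. -/
def sierpinskiRep : Representation Prop where
  Names p s := (∃ n, p n = 0) = s
  unique _ _ _ h h' := h.symm.trans h'
  surj s := by
    by_cases hs : s
    · exact ⟨fun _ => 0, by simp [hs]⟩
    · exact ⟨fun _ => 1, by simp [hs]⟩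

theorem pair_inj {p q p' q' : Baire} (h : pair p q = pair p' q') : p = p' ∧ q = q' := by
  constructor
  · funext n
    have := congrFun h (2 * n)
    simpa [pair] using this
  · funext n
    have := congrFun h (2 * n + 1)
    have h2 : (2 * n + 1) / 2 = n := by omega
    simpa [pair, h2, Nat.add_mod] using this

/-- The product representation `[δ, δ']⟨p, q⟩ = (δ(p), δ'(q))`. -/
def prodRep {X Y : Type} (δ : Representation X) (δ' : Representation Y) :
    Representation (X × Y) where
  Names r z := ∃ p q, r = pair p q ∧ δ.Names p z.1 ∧ δ'.Names q z.2
  unique := by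
    rintro r ⟨x, y⟩ ⟨x', y'⟩ ⟨p, q, rfl, hx, hy⟩ ⟨p', q', h, hx', hy'⟩
    obtain ⟨rfl, rfl⟩ := pair_inj h
    exact Prod.ext (δ.unique _ _ _ hx hx') (δ'.unique _ _ _ hy hy')
  surj z := by
    obtain ⟨p, hp⟩ := δ.surj z.1
    obtain ⟨q, hq⟩ := δ'.surj z.2
    exact ⟨pair p q, p, q, rfl, hp, hq⟩

/-! ### Function space, open and closed subsets -/

/-- A total single-valued function between represented spaces. -/
def ofFun {X Y : Type} (δ : Representation X) (δ' : Representation Y) (f : X → Y) : Problem :=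
  ⟨δ, δ', fun x => {f x}⟩

/-- `U ⊆ X` is open if its characteristic function into Sierpiński space has a continuous
realizer. -/
def IsOpenSet {X : Type} (δ : Representation X) (U : Set X) : Prop :=
  ∃ F : Baire →. Baire, IsContinuous F ∧ Realizes F (ofFun δ sierpinskiRep fun x => x ∈ U)

/-- `p` is a name of `f : X → Y` in the function space representation `[δ → δ']`:
`η_p` is a realizer of `f`. -/
def FunNames {X Y : Type} (δ : Representation X) (δ' : Representation Y) (p : Baire)
    (f : X → Y) : Prop :=
  Realizes (eta p) (ofFun δ δ' f)

theorem funNames_unique {X Y : Type} (δ : Representation X) (δ' : Representation Y) (p : Baire)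
    (f g : X → Y) (hf : FunNames δ δ' p f) (hg : FunNames δ δ' p g) : f = g := by
  funext x
  obtain ⟨r, hr⟩ := δ.surj x
  obtain ⟨q, hq, y, hy, hqy⟩ := hf r x hr ⟨_, rfl⟩
  obtain ⟨q', hq', y', hy', hqy'⟩ := hg r x hr ⟨_, rfl⟩
  obtain rfl := Part.mem_unique hq hq'
  have h1 : y = f x := hy
  have h2 : y' = g x := hy'
  rw [← h1, ← h2]
  exact δ'.unique _ _ _ hqy hqy'

theorem prefixCode_inj {p q : Baire} {k l : ℕ} (h : prefixCode p k = prefixCode q l) :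
    k = l ∧ ∀ i < k, p i = q i := by
  have h' := Encodable.encode_injective h
  have hkl : k = l := by simpa using congrArg List.length h'
  subst hkl
  refine ⟨rfl, fun i hi => ?_⟩
  exact List.map_inj_left.1 h' i (List.mem_range.2 hi)

/-- Every continuous partial function on Baire space is extended by some `η_α`. -/
theorem exists_eta_of_continuous {F : Baire →. Baire} (hF : IsContinuous F) :
    ∃ α : Baire, ∀ p, ∀ q ∈ F p, q ∈ eta α p := by
  classical
  let P : ℕ → ℕ → Prop := fun m v => ∃ n p k q, m = Nat.pair n (prefixCode p k) ∧ q ∈ F p ∧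
    q n = v ∧ ∀ p' q', q' ∈ F p' → (∀ i < k, p' i = p i) → q' n = v
  let α : Baire := fun m => if h : ∃ v, P m v then h.choose + 1 else 0
  refine ⟨α, fun p q hq => ?_⟩
  have sound : ∀ n k v, P (Nat.pair n (prefixCode p k)) v → v = q n := by
    rintro n k v ⟨n', p₁, k₁, q₁, hm, -, -, h⟩
    obtain ⟨rfl, hc⟩ := Nat.pair_eq_pair.1 hm
    obtain ⟨rfl, hi⟩ := prefixCode_inj hc
    exact (h p q hq hi).symm
  have complete : ∀ n, ∃ k, P (Nat.pair n (prefixCode p k)) (q n) := by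
    intro n
    have hpd : p ∈ F.Dom := Part.dom_iff_mem.2 ⟨q, hq⟩
    have hval : ∀ (p' : Baire) (h : p' ∈ F.Dom) (q' : Baire), q' ∈ F p' →
        F.asSubtype ⟨p', h⟩ = q' := fun p' h q' hq' => Part.get_eq_of_mem hq' h
    have hc : Continuous fun x : F.Dom => F.asSubtype x n := (continuous_apply n).comp hF
    have ho : IsOpen ((fun x : F.Dom => F.asSubtype x n) ⁻¹' {q n}) :=
      (isOpen_discrete _).preimage hc
    obtain ⟨O, hO, hOe⟩ := isOpen_induced_iff.1 ho
    have hpO : p ∈ O := by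
      have : (⟨p, hpd⟩ : F.Dom) ∈ Subtype.val ⁻¹' O := by
        rw [hOe]
        simp [hval p hpd q hq]
      exact this
    obtain ⟨I, u, hu, hsub⟩ := isOpen_pi_iff.1 hO p hpO
    obtain ⟨k, hk⟩ : ∃ k, ∀ i ∈ I, i < k := ⟨I.sup id + 1, fun i hi =>
      Nat.lt_succ_of_le (Finset.le_sup (f := id) hi)⟩
    refine ⟨k, n, p, k, q, rfl, hq, rfl, fun p' q' hq' hag => ?_⟩
    have hpd' : p' ∈ F.Dom := Part.dom_iff_mem.2 ⟨q', hq'⟩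
    have hp'O : p' ∈ O := hsub fun i hi => by
      rw [hag i (hk i hi)]
      exact (hu i hi).2
    have : (⟨p', hpd'⟩ : F.Dom) ∈ Subtype.val ⁻¹' O := hp'O
    rw [hOe] at this
    have h3 : F.asSubtype ⟨p', hpd'⟩ n = q n := this
    rwa [hval p' hpd' q' hq'] at h3
  have key : ∀ n, q n ∈ evalAt α p n := by
    intro n
    have hdom : (evalAt α p n).Dom := by
      obtain ⟨k, hk⟩ := complete n
      have hex : ∃ v, P (Nat.pair n (prefixCode p k)) v := ⟨_, hk⟩
      have h1 : α (Nat.pair n (prefixCode p k)) = hex.choose + 1 := dif_pos hex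
      exact Nat.rfindOpt_dom.2 ⟨k, hex.choose, by rw [h1]; rfl⟩
    have hmem := Part.get_mem hdom
    obtain ⟨k, hk⟩ := Nat.rfindOpt_spec hmem
    have hk' : α (Nat.pair n (prefixCode p k)) = ((evalAt α p n).get hdom).succ :=
      Nat.ppred_eq_some.1 hk |>.symm
    by_cases h : ∃ v, P (Nat.pair n (prefixCode p k)) v
    · have h1 : α (Nat.pair n (prefixCode p k)) = h.choose + 1 := dif_pos h
      have h2 := sound n k _ h.choose_spec
      have h3 : (evalAt α p n).get hdom = q n := by
        rw [h1, h2] at hk'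
        omega
      rwa [h3] at hmem
    · have h1 : α (Nat.pair n (prefixCode p k)) = 0 := dif_neg h
      rw [h1] at hk'
      omega
  have hd : (eta α p).Dom := fun n => Part.dom_iff_mem.2 ⟨_, key n⟩
  exact ⟨hd, funext fun n => Part.get_eq_of_mem (key n) (hd n)⟩

/-- The negative information representation of the space of closed subsets of a represented
space: `p` is a name of the closed set `A` if and only if `[δ → δ_𝕊](p)` is the characteristic
function of the complement of `A`. -/
def closedRep {X : Type} (δ : Representation X) :
    Representation {A : Set X // IsOpenSet δ Aᶜ} where
  Names p A := FunNames δ sierpinskiRep p fun x => x ∈ (A : Set X)ᶜ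
  unique p A B hA hB := by
    have h := funNames_unique _ _ _ _ _ hA hB
    exact Subtype.ext (compl_injective (Set.ext fun x => (congrFun h x).to_iff))
  surj A := by
    obtain ⟨F, hF, hr⟩ := A.2
    obtain ⟨α, hα⟩ := exists_eta_of_continuous hF
    refine ⟨α, fun p x hp hx => ?_⟩
    obtain ⟨q, hq, h⟩ := hr p x hp hx
    exact ⟨q, hα p q hq, h⟩

/-! ### The two problems -/

/-- Closed choice `C_X :⊆ 𝒜₋(X) ⇉ X, A ↦ A`, with domain the non-empty closed sets. -/
def closedChoice {X : Type} (δ : Representation X) : Problem :=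
  ⟨closedRep δ, δ, fun A => (A : Set X)⟩

/-- The standard enumeration of the c.e. open subsets of Baire space: `U_n` is the union of the
cylinders of all finite words in the domain of the `n`-th partial computable function. -/
def ceOpen (n : ℕ) : Set Baire :=
  {p | ∃ k, ((Denumerable.ofNat Nat.Partrec.Code n).eval (prefixCode p k)).Dom}

open Classical in
/-- The Turing jump operator `J : ℕ^ℕ → ℕ^ℕ`. -/
noncomputable def jump (p : Baire) : Baire := fun n => if p ∈ ceOpen n then 1 else 0

/-- The limit operation `lim :⊆ ℕ^ℕ → ℕ^ℕ, ⟨q₀, q₁, q₂, …⟩ ↦ lim qᵢ`, where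
`⟨q₀, q₁, q₂, …⟩(⟨i, j⟩) = qᵢ(j)`; its value is the set of all limits, which has at most one
element. -/
def limMap (q : Baire) : Set Baire :=
  {r | Tendsto (fun i j => q (Nat.pair i j)) atTop (𝓝 r)}

/-- The problem `L = J⁻¹ ∘ lim :⊆ ℕ^ℕ → ℕ^ℕ`. -/
noncomputable def low : Problem :=
  ⟨baireRep, baireRep, fun q => {p | jump p ∈ limMap q}⟩

end Weihrauch

/-! The reduction is a uniform low basis theorem. Let `p` name a non-empty closed `A`. By
compactness of Cantor space, whether a slice `{n} × 2^ℕ` contains a point of `A` outside finitely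
many given c.e. open sets is a co-c.e. question in `p`: a negative answer shows up at a finite
stage. Take the least `n` whose slice meets `A`, then decide for e = 0, 1, 2, … to stay outside
`U_e` whenever the earlier decisions allow it. Every decision is limit computable from `p`, and
together they are the jump of a point of `A`, so `lowSeq p` converges to that jump
(`exists_jump_mem_limMap_lowSeq`). Since `jump` is injective, `L` must return this very point.

For the converse, the same theorem is applied to a computable program that leaves some points alive
but no computable one. It yields a computable `q` with `L(q) = r` not computable. If `L` reduced to
closed choice, `q` would be sent to a computable name of a non-empty closed set, and from `q`
together with any point of a non-empty slice a computable operator would produce `r`. By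
compactness, finitely many steps suffice to see all surviving points of the slice agree on the value
at `m`, so `r` would be computable (`computable_of_forall_mem_eta`). -/

namespace Weihrauch

/-! ### Bounded quantifiers -/

section Primrec

variable {α β : Type*} [Primcodable α] [Primcodable β]

theorem primrecPred_exists_lt {f : α → ℕ} {R : α → ℕ → Prop} (hf : Primrec f)
    (hR : PrimrecRel R) : PrimrecPred fun a => ∃ x < f a, R a x := by
  have h : PrimrecRel fun (x : ℕ) (a : α) => R a x := PrimrecPred.comp hR (Primrec.snd.pair .fst)
  exact (h.exists_mem_list.comp (Primrec.list_range.comp hf) Primrec.id).of_eq fun a => by simp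

theorem primrecPred_forall_lt {f : α → ℕ} {R : α → ℕ → Prop} (hf : Primrec f)
    (hR : PrimrecRel R) : PrimrecPred fun a => ∀ x < f a, R a x := by
  have h : PrimrecRel fun (x : ℕ) (a : α) => R a x := PrimrecPred.comp hR (Primrec.snd.pair .fst)
  exact (h.forall_mem_list.comp (Primrec.list_range.comp hf) Primrec.id).of_eq fun a => by simp

theorem primrecPred_forall_mem {f : α → List β} {R : α → β → Prop} (hf : Primrec f)
    (hR : PrimrecRel R) : PrimrecPred fun a => ∀ x ∈ f a, R a x := by
  have h : PrimrecRel fun (x : β) (a : α) => R a x := PrimrecPred.comp hR (Primrec.snd.pair .fst)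
  exact (h.forall_mem_list.comp hf Primrec.id).of_eq fun a => by simp

theorem primrec_two_pow : Primrec fun n : ℕ => 2 ^ n :=
  (Primrec.nat_rec₁ (f := fun _ m => 2 * m) 1
    (Primrec.nat_mul.comp (.const 2) .snd).to₂).of_eq fun n => by
    induction n with
    | zero => rfl
    | succ n ih => exact (congrArg (2 * ·) ih).trans (pow_succ' 2 n).symm

end Primrec

/-! ### Initial segments and finite stages of computations -/

/-- The first `s` values of `p`. -/
def initSeg (p : Baire) (s : ℕ) : List ℕ := (List.range s).map p

@[simp] theorem length_initSeg (p : Baire) (s : ℕ) : (initSeg p s).length = s := by simp [initSeg]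

theorem initSeg_take (p : Baire) {k s : ℕ} (h : k ≤ s) : (initSeg p s).take k = initSeg p k := by
  simp [initSeg, ← List.map_take, List.take_range, Nat.min_eq_left h]

theorem initSeg_getElem?_eq_some {p : Baire} {s i v : ℕ} :
    (initSeg p s)[i]? = some v ↔ i < s ∧ p i = v := by
  simp only [initSeg, List.getElem?_map, Option.map_eq_some_iff, List.getElem?_eq_some_iff,
    List.length_range, List.getElem_range]
  constructor
  · rintro ⟨_, ⟨h, rfl⟩, rfl⟩
    exact ⟨h, rfl⟩
  · rintro ⟨h, rfl⟩
    exact ⟨i, ⟨h, rfl⟩, rfl⟩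

theorem initSeg_getD {p : Baire} {s i : ℕ} (h : i < s) (d : ℕ) : (initSeg p s).getD i d = p i := by
  rw [List.getD_eq_getElem?_getD, initSeg_getElem?_eq_some.2 ⟨h, rfl⟩, Option.getD_some]

theorem initSeg_congr {p q : Baire} {s : ℕ} (h : ∀ i < s, p i = q i) :
    initSeg p s = initSeg q s :=
  List.map_inj_left.2 fun i hi => h i (List.mem_range.1 hi)

theorem computable_initSeg {p : Baire} (hp : Computable p) : Computable (initSeg p) := by
  have h : Computable fun n : ℕ => Nat.rec (motive := fun _ => List ℕ) [] (fun k l => l ++ [p k]) n :=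
    Computable.nat_rec (f := fun n : ℕ => n) (g := fun _ => [])
      (h := fun (_ : ℕ) (x : ℕ × List ℕ) => x.2 ++ [p x.1]) .id (.const _)
      (Computable.list_concat.comp (Computable.snd.comp .snd)
        (hp.comp (Computable.fst.comp .snd))).to₂
  refine h.of_eq fun n => ?_
  induction n with
  | zero => rfl
  | succ n ih => simp only [ih, initSeg, List.range_succ, List.map_append, List.map_cons, List.map_nil]

theorem mem_evalAt {a p : Baire} {n v : ℕ} : v ∈ evalAt a p n ↔
    ∃ k, a (Nat.pair n (prefixCode p k)) = v + 1 ∧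
      ∀ l < k, a (Nat.pair n (prefixCode p l)) = 0 := by
  have hpp : ∀ m, (Nat.ppred m).isSome = false ↔ m = 0 := by
    intro m; cases m <;> simp
  have hps : ∀ m w, w ∈ Nat.ppred m ↔ m = w + 1 := fun m w => by
    rw [Option.mem_def, Nat.ppred_eq_some]; exact eq_comm
  refine Part.mem_bind_iff.trans (exists_congr fun k => ?_)
  rw [Part.mem_ofOption, hps]
  constructor
  · rintro ⟨h, hk⟩
    exact ⟨hk, fun l hl => (hpp _).1 (Part.mem_some_iff.1 ((Nat.mem_rfind.1 h).2 hl)).symm⟩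
  · rintro ⟨hk, h⟩
    exact ⟨Nat.mem_rfind.2 ⟨by simp [hk], fun hl => by simp [h _ hl]⟩, hk⟩

/-- The finite part `P` of a program, run on argument `m` with the finite part `W` of an oracle,
answers `v`. -/
def Answers (P W : List ℕ) (m v : ℕ) : Prop :=
  ∃ k < W.length + 1, P[Nat.pair m (Encodable.encode (W.take k))]? = some (v + 1) ∧
    ∀ l < k, P[Nat.pair m (Encodable.encode (W.take l))]? = some 0

theorem answers_initSeg {a p : Baire} {s t m v : ℕ} :
    Answers (initSeg a s) (initSeg p t) m v ↔
      ∃ k ≤ t, (Nat.pair m (prefixCode p k) < s ∧ a (Nat.pair m (prefixCode p k)) = v + 1) ∧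
        ∀ l < k, Nat.pair m (prefixCode p l) < s ∧ a (Nat.pair m (prefixCode p l)) = 0 := by
  unfold Answers
  rw [length_initSeg]
  refine exists_congr fun k => ?_
  rw [Nat.lt_succ_iff]
  refine and_congr_right fun hk => ?_
  rw [initSeg_take p hk]
  refine and_congr initSeg_getElem?_eq_some (forall₂_congr fun l hl => ?_)
  rw [initSeg_take p (hl.le.trans hk)]
  exact initSeg_getElem?_eq_some

/-- Looking past the end of a finite program gives `none`, which is neither an answer nor a request
to read on. A later stage can therefore never revoke an answer. -/
theorem Answers.mono {a p : Baire} {s t m v : ℕ} (hst : s ≤ t)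
    (h : Answers (initSeg a s) (initSeg p s) m v) : Answers (initSeg a t) (initSeg p t) m v := by
  rw [answers_initSeg] at h ⊢
  obtain ⟨k, hk, ⟨h1, h2⟩, h3⟩ := h
  exact ⟨k, hk.trans hst, ⟨h1.trans_le hst, h2⟩, fun l hl => ⟨(h3 l hl).1.trans_le hst, (h3 l hl).2⟩⟩

theorem mem_evalAt_iff_exists_answers {a p : Baire} {m v : ℕ} :
    v ∈ evalAt a p m ↔ ∃ s, Answers (initSeg a s) (initSeg p s) m v := by
  simp only [mem_evalAt, answers_initSeg]
  constructor
  · rintro ⟨k, h1, h2⟩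
    -- `b` exceeds the codes of all queries made up to prefix length `k`, so none of them falls off
    -- the finite program.
    obtain ⟨b, hb⟩ := ((Finset.range (k + 1)).image
      fun l => Nat.pair m (prefixCode p l)).exists_nat_subset_range
    have hlt : ∀ l ≤ k, Nat.pair m (prefixCode p l) < b := fun l hl =>
      Finset.mem_range.1 (hb (Finset.mem_image_of_mem _ (Finset.mem_range.2 (by omega))))
    exact ⟨k + b, k, by omega, ⟨(hlt k le_rfl).trans_le (by omega), h1⟩,
      fun l hl => ⟨(hlt l hl.le).trans_le (by omega), h2 l hl⟩⟩
  · rintro ⟨s, k, -, ⟨-, h1⟩, h2⟩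
    exact ⟨k, h1, fun l hl => (h2 l hl).2⟩

/-- The finite program `P` gives the answer `0` on some argument, with oracle `W`. -/
def Kills (P W : List ℕ) : Prop := ∃ m < P.length, Answers P W m 0

theorem Kills.mono {a p : Baire} {s t : ℕ} (hst : s ≤ t)
    (h : Kills (initSeg a s) (initSeg p s)) : Kills (initSeg a t) (initSeg p t) := by
  obtain ⟨m, hm, h⟩ := h
  rw [length_initSeg] at hm
  exact ⟨m, by rw [length_initSeg]; omega, h.mono hst⟩

theorem exists_kills_iff {a p : Baire} :
    (∃ s, Kills (initSeg a s) (initSeg p s)) ↔ ∃ m, 0 ∈ evalAt a p m := by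
  constructor
  · rintro ⟨s, m, -, h⟩
    exact ⟨m, mem_evalAt_iff_exists_answers.2 ⟨s, h⟩⟩
  · rintro ⟨m, h⟩
    obtain ⟨s, h⟩ := mem_evalAt_iff_exists_answers.1 h
    exact ⟨s + m + 1, m, by rw [length_initSeg]; omega, h.mono (by omega)⟩

/-- The word `W` is seen to lie in the `e`-th c.e. open set within `W.length` steps. -/
def Enumerates (e : ℕ) (W : List ℕ) : Prop :=
  ∃ k < W.length + 1, ((Denumerable.ofNat Nat.Partrec.Code e).evaln W.length
    (Encodable.encode (W.take k))).isSome = true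

theorem enumerates_initSeg {e s : ℕ} {p : Baire} : Enumerates e (initSeg p s) ↔
    ∃ k ≤ s, ((Denumerable.ofNat Nat.Partrec.Code e).evaln s (prefixCode p k)).isSome = true := by
  unfold Enumerates
  rw [length_initSeg]
  refine exists_congr fun k => ?_
  rw [Nat.lt_succ_iff]
  refine and_congr_right fun hk => ?_
  rw [initSeg_take p hk]
  rfl

theorem Enumerates.mono {e s t : ℕ} {p : Baire} (hst : s ≤ t) (h : Enumerates e (initSeg p s)) :
    Enumerates e (initSeg p t) := by
  rw [enumerates_initSeg] at h ⊢
  obtain ⟨k, hk, h⟩ := h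
  obtain ⟨v, hv⟩ := Option.isSome_iff_exists.1 h
  exact ⟨k, hk.trans hst, Option.isSome_iff_exists.2 ⟨v, Nat.Partrec.Code.evaln_mono hst hv⟩⟩

theorem mem_ceOpen_iff_exists_enumerates {e : ℕ} {p : Baire} :
    p ∈ ceOpen e ↔ ∃ s, Enumerates e (initSeg p s) := by
  constructor
  · rintro ⟨k, hk⟩
    obtain ⟨v, hv⟩ := Part.dom_iff_mem.1 hk
    obtain ⟨s, hs⟩ := Nat.Partrec.Code.evaln_complete.1 hv
    exact ⟨k + s, enumerates_initSeg.2 ⟨k, by omega,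
      Option.isSome_iff_exists.2 ⟨v, Nat.Partrec.Code.evaln_mono (by omega) hs⟩⟩⟩
  · rintro ⟨s, h⟩
    obtain ⟨k, -, h⟩ := enumerates_initSeg.1 h
    obtain ⟨v, hv⟩ := Option.isSome_iff_exists.1 h
    exact ⟨k, Part.dom_iff_mem.2 ⟨v, Nat.Partrec.Code.evaln_sound hv⟩⟩

section Primrec

variable {α : Type*} [Primcodable α]

theorem primrecPred_answers {P W : α → List ℕ} {m v : α → ℕ} (hP : Primrec P) (hW : Primrec W)
    (hm : Primrec m) (hv : Primrec v) : PrimrecPred fun a => Answers (P a) (W a) (m a) (v a) := by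
  have hq : ∀ {β : Type _} [Primcodable β] {f : β → α} {k : β → ℕ}, Primrec f → Primrec k →
      Primrec fun b => (P (f b))[Nat.pair (m (f b)) (Encodable.encode ((W (f b)).take (k b)))]? := by
    intro β _ f k hf hk
    exact Primrec.list_getElem?.comp (hP.comp hf) (Primrec₂.natPair.comp (hm.comp hf)
      (Primrec.encode.comp (Primrec.list_take.comp hk (hW.comp hf))))
  refine primrecPred_exists_lt (Primrec.succ.comp (Primrec.list_length.comp hW)) ?_
  refine PrimrecPred.and ?_ ?_
  · exact Primrec.eq.comp (hq .fst .snd)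
      (Primrec.option_some.comp (Primrec.succ.comp (hv.comp .fst)))
  · refine primrecPred_forall_lt Primrec.snd ?_
    exact Primrec.eq.comp (hq (Primrec.fst.comp .fst) .snd) (.const _)

theorem primrecPred_kills {P W : α → List ℕ} (hP : Primrec P) (hW : Primrec W) :
    PrimrecPred fun a => Kills (P a) (W a) :=
  primrecPred_exists_lt (Primrec.list_length.comp hP)
    (primrecPred_answers (hP.comp .fst) (hW.comp .fst) .snd (.const 0))

theorem primrecPred_enumerates {e : α → ℕ} {W : α → List ℕ} (he : Primrec e) (hW : Primrec W) :
    PrimrecPred fun a => Enumerates (e a) (W a) := by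
  refine primrecPred_exists_lt (Primrec.succ.comp (Primrec.list_length.comp hW)) ?_
  refine Primrec.eq.comp (Primrec.option_isSome.comp ?_) (.const true)
  exact Nat.Partrec.Code.primrec_evaln.comp
    (((Primrec.list_length.comp (hW.comp .fst)).pair ((Primrec.ofNat _).comp (he.comp .fst))).pair
      (Primrec.encode.comp (Primrec.list_take.comp .snd (hW.comp .fst))))

end Primrec

/-! ### Points of `ℕ × 2^ℕ` -/

/-- The name of the point `(n, x)` of `ℕ × 2^ℕ` in which `n` is named by a constant sequence. -/
def pointName (n : ℕ) (x : ℕ → Bool) : Baire := pair (fun _ => n) fun j => (x j).toNat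

theorem names_pointName (n : ℕ) (x : ℕ → Bool) :
    (prodRep natRep cantorRep).Names (pointName n x) (n, x) :=
  ⟨_, _, rfl, rfl, rfl⟩

theorem initSeg_pointName_congr {n s : ℕ} {x y : ℕ → Bool} (h : ∀ i < s, x i = y i) :
    initSeg (pointName n x) s = initSeg (pointName n y) s :=
  initSeg_congr fun i hi => by simp only [pointName, pair, h (i / 2) (by omega)]

/-- A stage `s` computation sees at most `s` bits of `x`, so quantifying over Cantor space becomes a
bounded search over `i < 2 ^ s`. -/
theorem exists_testBit_eq (x : ℕ → Bool) (s : ℕ) :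
    ∃ i < 2 ^ s, ∀ j < s, x j = i.testBit j := by
  refine ⟨(BitVec.ofFnLE fun j : Fin s => x j).toNat, BitVec.isLt _, fun j hj => ?_⟩
  rw [BitVec.testBit_toNat, BitVec.getLsbD_ofFnLE]
  simp [hj]

theorem primrec_initSeg_pointName {α : Type*} [Primcodable α] {n i s : α → ℕ} (hn : Primrec n)
    (hi : Primrec i) (hs : Primrec s) :
    Primrec fun a => initSeg (pointName (n a) (i a).testBit) (s a) := by
  refine Primrec.list_map (Primrec.list_range.comp hs) ?_
  refine Primrec.ite (Primrec.eq.comp (Primrec.nat_mod.comp .snd (.const 2)) (.const 0))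
    (hn.comp .fst) ?_
  refine Primrec.of_eq (f := fun b : α × ℕ => i b.1 / 2 ^ (b.2 / 2) % 2) ?_ fun b =>
    (Nat.toNat_testBit _ _).symm
  exact Primrec.nat_mod.comp (Primrec.nat_div.comp (hi.comp .fst)
    (primrec_two_pow.comp (Primrec.nat_div.comp .snd (.const 2)))) (.const 2)

/-! ### Compactness of Cantor space -/

/-- König's lemma: a condition on finitely many coordinates is closed, and nested non-empty closed
subsets of a compact space have a common point. All uses of compactness go through this statement.
-/
theorem exists_forall_of_antitone {T : ℕ → (ℕ → Bool) → Prop}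
    (hloc : ∀ s x y, (∀ i < s, x i = y i) → T s x → T s y)
    (hanti : ∀ s x, T (s + 1) x → T s x) (hne : ∀ s, ∃ x, T s x) : ∃ x, ∀ s, T s x := by
  have hcl : ∀ s, IsClosed {x | T s x} := by
    intro s
    have h : {x | T s x} = (fun (x : ℕ → Bool) (i : Fin s) => x i) ⁻¹'
        ((fun (x : ℕ → Bool) (i : Fin s) => x i) '' {x | T s x}) := by
      refine Set.Subset.antisymm (Set.subset_preimage_image _ _) ?_
      rintro y ⟨x, hx, hxy⟩
      exact hloc s x y (fun i hi => congrFun hxy ⟨i, hi⟩) hx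
    rw [h]
    exact (isClosed_discrete _).preimage (continuous_pi fun i => continuous_apply _)
  obtain ⟨x, hx⟩ := IsCompact.nonempty_iInter_of_sequence_nonempty_isCompact_isClosed
    (fun s => {x | T s x}) hanti hne (hcl 0).isCompact hcl
  exact ⟨x, fun s => Set.mem_iInter.1 hx s⟩

/-! ### The low basis theorem -/

/-- The point `(n, x)` is not killed by the finite program `P`, nor enumerated into one of the c.e.
open sets with index in `D`, within `P.length` steps. -/
def Survives (P : List ℕ) (n : ℕ) (D : List ℕ) (x : ℕ → Bool) : Prop :=
  ¬ Kills P (initSeg (pointName n x) P.length) ∧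
    ∀ e ∈ D, ¬ Enumerates e (initSeg (pointName n x) P.length)

/-- Some point of `{n} × 2^ℕ` survives. -/
def Consistent (P : List ℕ) (n : ℕ) (D : List ℕ) : Prop :=
  ∃ i < 2 ^ P.length, Survives P n D i.testBit

theorem survives_congr {P D : List ℕ} {n : ℕ} {x y : ℕ → Bool} (h : ∀ i < P.length, x i = y i) :
    Survives P n D x ↔ Survives P n D y := by
  unfold Survives
  rw [initSeg_pointName_congr h]

theorem consistent_iff {P D : List ℕ} {n : ℕ} : Consistent P n D ↔ ∃ x, Survives P n D x := by
  constructor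
  · rintro ⟨i, -, h⟩
    exact ⟨_, h⟩
  · rintro ⟨x, hx⟩
    obtain ⟨i, hi, h⟩ := exists_testBit_eq x P.length
    exact ⟨i, hi, (survives_congr h).1 hx⟩

theorem Survives.anti {p : Baire} {s t n : ℕ} {D D' : List ℕ} {x : ℕ → Bool} (hst : s ≤ t)
    (hD : D ⊆ D') (h : Survives (initSeg p t) n D' x) : Survives (initSeg p s) n D x := by
  simp only [Survives, length_initSeg] at h ⊢
  exact ⟨fun hk => h.1 (hk.mono hst), fun e he hk => h.2 e (hD he) (hk.mono hst)⟩

section Primrec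

variable {α : Type*} [Primcodable α]

theorem primrecPred_consistent {P D : α → List ℕ} {n : α → ℕ} (hP : Primrec P) (hn : Primrec n)
    (hD : Primrec D) : PrimrecPred fun a => Consistent (P a) (n a) (D a) := by
  refine primrecPred_exists_lt (primrec_two_pow.comp (Primrec.list_length.comp hP)) ?_
  have hW : Primrec fun b : α × ℕ => initSeg (pointName (n b.1) b.2.testBit) (P b.1).length :=
    primrec_initSeg_pointName (hn.comp .fst) .snd (Primrec.list_length.comp (hP.comp .fst))
  refine PrimrecPred.and (primrecPred_kills (hP.comp .fst) hW).not ?_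
  exact primrecPred_forall_mem (hD.comp .fst)
    (primrecPred_enumerates .snd (hW.comp .fst)).not

end Primrec

open Classical in
/-- The list of those `e' < e` which are accepted by the greedy algorithm that keeps the predicate
`R` true. -/
noncomputable def greedy (R : List ℕ → Prop) : ℕ → List ℕ
  | 0 => []
  | e + 1 => if R (e :: greedy R e) then e :: greedy R e else greedy R e

open Classical in
/-- The least `n` for which `{n} × 2^ℕ` has a point surviving `P`. -/
noncomputable def leastIndex (P : List ℕ) : ℕ :=
  -- If no index qualifies the value is `P.length`; this happens only at stages not beyond the true
  -- index, hence not in the limit.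
  (List.range P.length).findIdx fun n => decide (Consistent P n [])

open Classical in
/-- The guess for the value at `e` of the jump of the low point, from the information `P`. -/
noncomputable def jumpGuess (P : List ℕ) (e : ℕ) : ℕ :=
  if Consistent P (leastIndex P) (e :: greedy (Consistent P (leastIndex P)) e) then 0 else 1

/-- A sequence that converges to the jump of a low point of the closed set named by `p`. -/
noncomputable def lowSeq (p : Baire) : Baire := fun N =>
  jumpGuess (initSeg p N.unpair.1) N.unpair.2

theorem primrec_leastIndex : Primrec leastIndex := by
  classical
  exact Primrec.list_findIdx (Primrec.list_range.comp Primrec.list_length)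
    (PrimrecPred.decide (p := fun b : List ℕ × ℕ => Consistent b.1 b.2 [])
      (primrecPred_consistent .fst .snd (.const [])))

theorem primrec_greedy :
    Primrec₂ fun (P : List ℕ) (e : ℕ) => greedy (Consistent P (leastIndex P)) e := by
  classical
  have hs : Primrec fun b : (List ℕ × ℕ) × ℕ × List ℕ => b.2.1 :: b.2.2 :=
    Primrec.list_cons.comp (Primrec.fst.comp .snd) (Primrec.snd.comp .snd)
  refine Primrec.of_eq (Primrec.nat_rec' (f := fun a : List ℕ × ℕ => a.2) (g := fun _ => [])
    (h := fun a b => if Consistent a.1 (leastIndex a.1) (b.1 :: b.2) then b.1 :: b.2 else b.2)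
    .snd (.const _) (Primrec.ite (primrecPred_consistent (Primrec.fst.comp .fst)
      (primrec_leastIndex.comp (Primrec.fst.comp .fst)) hs) hs
      (Primrec.snd.comp .snd))) fun a => ?_
  obtain ⟨P, e⟩ := a
  induction e with
  | zero => rfl
  | succ e ih =>
    have ih' : Nat.rec _ _ e = greedy (Consistent P (leastIndex P)) e := ih
    simp only [greedy, ih']

theorem primrec_jumpGuess : Primrec₂ jumpGuess := by
  classical
  exact Primrec.ite (primrecPred_consistent .fst (primrec_leastIndex.comp .fst)
    (Primrec.list_cons.comp .snd primrec_greedy)) (.const 0) (.const 1)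

/-- `{n} × 2^ℕ` has a point which is never killed by `p` nor enumerated into one of the c.e. open
sets with index in `D`. -/
def LimConsistent (p : Baire) (n : ℕ) (D : List ℕ) : Prop :=
  ∃ x, ∀ s, Survives (initSeg p s) n D x

/-- Compactness exchanges the quantifiers: one point surviving all stages against a possibly
different point for each stage. This makes the left side co-c.e. in `p`. -/
theorem limConsistent_iff {p : Baire} {n : ℕ} {D : List ℕ} :
    LimConsistent p n D ↔ ∀ s, Consistent (initSeg p s) n D := by
  simp only [consistent_iff]
  refine ⟨fun ⟨x, hx⟩ s => ⟨x, hx s⟩, fun h => exists_forall_of_antitone ?_ ?_ h⟩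
  · intro s x y hxy
    exact (survives_congr (by simpa using hxy)).1
  · exact fun s x h => h.anti s.le_succ (List.Subset.refl _)

/-- The finite-stage answer changes at most once, from true to false. -/
theorem eventually_consistent_iff (p : Baire) (n : ℕ) (D : List ℕ) :
    ∀ᶠ s in atTop, (Consistent (initSeg p s) n D ↔ LimConsistent p n D) := by
  by_cases h : LimConsistent p n D
  · exact Eventually.of_forall fun s => iff_of_true (limConsistent_iff.1 h s) h
  · obtain ⟨s, hs⟩ := not_forall.1 (mt limConsistent_iff.2 h)
    refine eventually_atTop.2 ⟨s, fun t hst => iff_of_false (fun ht => hs ?_) h⟩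
    rw [consistent_iff] at ht ⊢
    exact ht.imp fun x hx => hx.anti hst (List.Subset.refl _)

theorem eventually_leastIndex_eq {p : Baire} {n : ℕ} (h : LimConsistent p n [])
    (hmin : ∀ m < n, ¬ LimConsistent p m []) : ∀ᶠ s in atTop, leastIndex (initSeg p s) = n := by
  have h1 : ∀ᶠ s in atTop, ∀ m ∈ Finset.range n,
      (Consistent (initSeg p s) m [] ↔ LimConsistent p m []) :=
    (Finset.eventually_all _).2 fun m _ => eventually_consistent_iff p m []
  filter_upwards [h1, eventually_gt_atTop n] with s hs hns
  refine (List.findIdx_eq (by simpa using hns)).2 ⟨?_, fun m hm => ?_⟩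
  · simpa using limConsistent_iff.1 h s
  · simpa using mt (hs m (Finset.mem_range.2 hm)).1 (hmin m hm)

/-- Only finitely many questions enter the first `e` decisions, and each of them settles. -/
theorem eventually_greedy_eq (p : Baire) (n e : ℕ) :
    ∀ᶠ s in atTop, greedy (Consistent (initSeg p s) n) e = greedy (LimConsistent p n) e := by
  induction e with
  | zero => exact Eventually.of_forall fun s => rfl
  | succ e ih =>
    filter_upwards [ih, eventually_consistent_iff p n (e :: greedy (LimConsistent p n) e)]
      with s hs hc
    rw [greedy, greedy, hs]
    by_cases h : LimConsistent p n (e :: greedy (LimConsistent p n) e)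
    · rw [if_pos h, if_pos (hc.2 h)]
    · rw [if_neg h, if_neg (mt hc.1 h)]

theorem greedy_spec {R : List ℕ → Prop} (h : R []) (e : ℕ) : R (greedy R e) := by
  induction e with
  | zero => exact h
  | succ e ih =>
    rw [greedy]
    split_ifs with he
    · exact he
    · exact ih

theorem greedy_subset {R : List ℕ → Prop} {e e' : ℕ} (h : e ≤ e') : greedy R e ⊆ greedy R e' := by
  induction e', h using Nat.le_induction with
  | base => exact List.Subset.refl _
  | succ e' _ ih =>
    rw [greedy]
    split_ifs
    · exact List.subset_cons_of_subset _ ih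
    · exact ih

theorem limConsistent_nil_iff {p : Baire} {n : ℕ} :
    LimConsistent p n [] ↔ ∃ x, ∀ m, 0 ∉ evalAt p (pointName n x) m := by
  refine exists_congr fun x => ?_
  rw [← not_exists, ← exists_kills_iff, not_exists]
  simp [Survives]

/-- The low basis theorem for `ℕ × 2^ℕ`, uniformly: if the program `p` does not give the answer `0`
for all points, then `lowSeq p` converges to the jump of a point for which it does not. -/
theorem exists_jump_mem_limMap_lowSeq {p : Baire}
    (hp : ∃ n x, ∀ m, 0 ∉ evalAt p (pointName n x) m) :
    ∃ n x, (∀ m, 0 ∉ evalAt p (pointName n x) m) ∧ jump (pointName n x) ∈ limMap (lowSeq p) := by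
  classical
  have hex : ∃ n, LimConsistent p n [] := hp.imp fun n => limConsistent_nil_iff.2
  obtain ⟨n, hn, hmin⟩ : ∃ n, LimConsistent p n [] ∧ ∀ m < n, ¬ LimConsistent p m [] :=
    ⟨_, Nat.find_spec hex, fun m => Nat.find_min hex⟩
  -- Stage `s` imposes the kills seen by then and the first `s` decisions. Each finite set of
  -- accepted decisions is realised by some point, so compactness gives one point obeying them all.
  obtain ⟨x, hx⟩ : ∃ x, ∀ s, Survives (initSeg p s) n (greedy (LimConsistent p n) s) x := by
    refine exists_forall_of_antitone ?_ ?_ ?_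
    · intro s x y hxy
      exact (survives_congr (by simpa using hxy)).1
    · exact fun s x h => h.anti s.le_succ (greedy_subset s.le_succ)
    · exact fun s => (greedy_spec hn s).imp fun x hx => hx s
  have hxD : ∀ e s, Survives (initSeg p s) n (greedy (LimConsistent p n) e) x := fun e s =>
    (hx (max e s)).anti (le_max_right _ _) (greedy_subset (le_max_left _ _))
  -- The point `x` decides every question: if avoiding `U_e` was accepted, then `x` avoids it; if
  -- `x` avoids it, then `x` itself witnesses that acceptance was possible.
  have hlim : ∀ e, LimConsistent p n (e :: greedy (LimConsistent p n) e) ↔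
      pointName n x ∉ ceOpen e := by
    intro e
    rw [mem_ceOpen_iff_exists_enumerates, not_exists]
    constructor
    · intro h s
      have := (hxD (e + 1) s).2 e (by rw [greedy, if_pos h]; exact List.mem_cons_self)
      rwa [length_initSeg] at this
    · intro h
      refine ⟨x, fun s => ⟨(hxD e s).1, fun e' he' => ?_⟩⟩
      rcases List.mem_cons.1 he' with rfl | he'
      · rw [length_initSeg]
        exact h s
      · exact (hxD e s).2 e' he'
  refine ⟨n, x, fun m hm => ?_, tendsto_pi_nhds.2 fun e => ?_⟩
  · obtain ⟨s, hs⟩ := exists_kills_iff.2 ⟨m, hm⟩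
    refine (hx s).1 ?_
    rwa [length_initSeg]
  · refine tendsto_const_nhds.congr' ?_
    filter_upwards [eventually_leastIndex_eq hn hmin, eventually_greedy_eq p n e,
      eventually_consistent_iff p n (e :: greedy (LimConsistent p n) e)] with s h1 h2 h3
    simp only [lowSeq, Nat.unpair_pair, jumpGuess, h1, h2, h3, hlim, jump]
    split_ifs <;> simp_all

/-! ### Computable operators -/

theorem mem_eta {a p q : Baire} : q ∈ eta a p ↔ ∀ n, q n ∈ evalAt a p n := by
  constructor
  · rintro ⟨h, rfl⟩ n
    exact Part.get_mem (h n)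
  · intro h
    exact ⟨fun n => Part.dom_iff_mem.2 ⟨_, h n⟩, funext fun n =>
      Part.get_eq_of_mem (h n) (Part.dom_iff_mem.2 ⟨_, h n⟩)⟩

/-- The program reads on until the prefix has length exactly `g n`, then answers. -/
theorem isComputable_of_initSeg {f : List ℕ → ℕ → ℕ} {g : ℕ → ℕ} (hf : Primrec₂ f)
    (hg : Primrec g) : IsComputable fun p => Part.some fun n => f (initSeg p (g n)) n := by
  have hL : Primrec fun N : ℕ => Denumerable.ofNat (List ℕ) N.unpair.2 :=
    (Primrec.ofNat _).comp (Primrec.snd.comp .unpair)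
  have h1 : Primrec fun N : ℕ => N.unpair.1 := Primrec.fst.comp .unpair
  refine ⟨fun N => if (Denumerable.ofNat (List ℕ) N.unpair.2).length = g N.unpair.1 then
    f (Denumerable.ofNat (List ℕ) N.unpair.2) N.unpair.1 + 1 else 0, ?_, ?_⟩
  · exact (Primrec.ite (Primrec.eq.comp (Primrec.list_length.comp hL) (hg.comp h1))
      (Primrec.succ.comp (hf.comp hL h1)) (.const 0)).to_comp
  · intro p q hq
    obtain rfl := Part.mem_some_iff.1 hq
    have hdec : ∀ k, Denumerable.ofNat (List ℕ) (prefixCode p k) = initSeg p k := fun k =>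
      Denumerable.ofNat_encode _
    refine mem_eta.2 fun n => mem_evalAt.2 ⟨g n, ?_, fun l hl => ?_⟩
    · simp [hdec]
    · simp [hdec, hl.ne]

theorem computable_of_mem_eta {a p q : Baire} (ha : Computable a) (hp : Computable p)
    (hq : q ∈ eta a p) : Computable q := by
  have hpp : Primrec Nat.ppred := (Primrec.nat_casesOn .id (.const none)
    (Primrec.option_some.comp .snd).to₂).of_eq fun n => by cases n <;> rfl
  have h : Partrec fun n => evalAt a p n := Partrec.rfindOpt
    (f := fun n k => Nat.ppred (a (Nat.pair n (prefixCode p k))))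
    (hpp.to_comp.comp (ha.comp (Primrec₂.natPair.to_comp.comp .fst
      (Primrec.encode.to_comp.comp ((computable_initSeg hp).comp .snd))))).to₂
  exact h.of_eq fun n => Part.eq_some_iff.2 (mem_eta.1 hq n)

theorem computable_lowSeq {p : Baire} (hp : Computable p) : Computable (lowSeq p) :=
  primrec_jumpGuess.to_comp.comp
    ((computable_initSeg hp).comp (Primrec.fst.comp .unpair).to_comp)
    (Primrec.snd.comp .unpair).to_comp

/-! ### Closed choice is reducible to `low` -/

/-- Negative information: a value `0` is produced exactly when the point lies outside the closed
set. -/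
theorem mem_iff_of_closedRep_names {X : Type} {δ : Representation X} {p r : Baire} {x : X}
    {A : {A : Set X // IsOpenSet δ Aᶜ}} (hp : (closedRep δ).Names p A) (hr : δ.Names r x) :
    x ∈ (A : Set X) ↔ ∀ m, 0 ∉ evalAt p r m := by
  obtain ⟨q, hq, y, hy, hqy⟩ := hp r x hr ⟨_, rfl⟩
  have h1 : y = (x ∈ (A : Set X)ᶜ) := hy
  have h2 : (∃ m, q m = 0) ↔ x ∉ (A : Set X) := (hqy.trans h1).to_iff
  rw [← not_iff_not, ← h2, not_forall]
  simp only [not_not]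
  have h3 := mem_eta.1 hq
  exact exists_congr fun m => ⟨fun h => h ▸ h3 m, fun h => Part.mem_unique (h3 m) h⟩

theorem exists_ceOpen_eq (i v : ℕ) : ∃ e, ceOpen e = {p | p i = v} := by
  have hf : Primrec fun N : ℕ => if (Denumerable.ofNat (List ℕ) N)[i]? = some v then
      some 0 else none :=
    Primrec.ite (Primrec.eq.comp (Primrec.list_getElem?.comp (Primrec.ofNat _) (.const i))
      (.const (some v))) (.const (some 0)) (.const none)
  obtain ⟨c, hc⟩ := Nat.Partrec.Code.exists_code.1 (Partrec.nat_iff.1 hf.to_comp.ofOption)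
  have hdec : ∀ p k, Denumerable.ofNat (List ℕ) (prefixCode p k) = initSeg p k := fun p k =>
    Denumerable.ofNat_encode _
  refine ⟨Encodable.encode c, Set.ext fun p => ?_⟩
  simp only [ceOpen, Denumerable.ofNat_encode, hc, Set.mem_ofPred_eq, hdec,
    initSeg_getElem?_eq_some]
  constructor
  · rintro ⟨k, hk⟩
    by_contra h
    simp [h] at hk
  · intro h
    exact ⟨i + 1, by simp [h]⟩

/-- The conditions `p i = v` define c.e. open sets, so the jump determines every value of `p`. -/
theorem jump_injective : Function.Injective jump := by
  intro p q h
  funext i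
  obtain ⟨e, he⟩ := exists_ceOpen_eq i (p i)
  have h1 : p ∈ ceOpen e := by rw [he]; rfl
  have h2 : q ∈ ceOpen e := by
    by_contra hq
    have := congrFun h e
    simp [jump, h1, hq] at this
  rw [he] at h2
  exact h2.symm

theorem eq_of_jump_mem_limMap {p p' q : Baire} (h : jump p ∈ limMap q) (h' : jump p' ∈ limMap q) :
    p = p' :=
  jump_injective (tendsto_nhds_unique h h')

/-- The jump has only one preimage, so any realizer returns `pointName n x` itself. This is already
a name of a solution and needs no post-processing. -/
theorem exists_mem_of_realizes_low {G : Baire →. Baire} (hG : Realizes G low) {p : Baire}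
    {A : {A : Set (ℕ × (ℕ → Bool)) // IsOpenSet (prodRep natRep cantorRep) Aᶜ}}
    (hp : (closedRep (prodRep natRep cantorRep)).Names p A) (hA : A.1.Nonempty) :
    ∃ n x, (n, x) ∈ (A : Set (ℕ × (ℕ → Bool))) ∧ pointName n x ∈ G (lowSeq p) := by
  have hmem := fun n x => mem_iff_of_closedRep_names hp (names_pointName n x)
  obtain ⟨⟨n₀, x₀⟩, h₀⟩ := hA
  obtain ⟨n, x, hx, hj⟩ := exists_jump_mem_limMap_lowSeq ⟨n₀, x₀, (hmem _ _).1 h₀⟩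
  obtain ⟨q, hq, y, hy, hqy⟩ := hG (lowSeq p) (lowSeq p) rfl ⟨_, hj⟩
  have hqy : q = y := hqy
  obtain rfl : q = pointName n x := hqy.trans (eq_of_jump_mem_limMap hy hj)
  exact ⟨n, x, (hmem _ _).2 hx, hq⟩

theorem isComputable_lowSeq : IsComputable fun p => Part.some (lowSeq p) :=
  isComputable_of_initSeg (f := fun L N => jumpGuess L N.unpair.2) (g := fun N => N.unpair.1)
    (primrec_jumpGuess.comp .fst (Primrec.snd.comp (Primrec.unpair.comp .snd)))
    (Primrec.fst.comp .unpair)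

theorem isComputable_id : IsComputable fun p => Part.some p := by
  have h := isComputable_of_initSeg (f := fun L n => L.getD n 0) (g := Nat.succ)
    (Primrec.list_getD 0) Primrec.succ
  simpa only [initSeg_getD (Nat.lt_succ_self _)] using h

theorem isComputable_snd : IsComputable fun p => Part.some fun n => p (2 * n + 1) := by
  have h1 : Primrec fun n : ℕ => 2 * n + 1 :=
    Primrec.succ.comp (Primrec.nat_mul.comp (.const 2) .id)
  have h := isComputable_of_initSeg (f := fun L n => L.getD (2 * n + 1) 0)
    (g := fun n => 2 * n + 1 + 1)
    ((Primrec.list_getD 0).comp .fst (h1.comp .snd)) (Primrec.succ.comp h1)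
  simpa only [initSeg_getD (Nat.lt_succ_self _)] using h

theorem pair_odd (p q : Baire) : (fun n => pair p q (2 * n + 1)) = q := by
  funext n
  have h2 : (2 * n + 1) / 2 = n := by omega
  simp [pair, h2, Nat.add_mod]

theorem strongReducible_closedChoice_low :
    StrongReducible (closedChoice (prodRep natRep cantorRep)) low := by
  refine ⟨_, _, isComputable_id, isComputable_lowSeq, fun G hG p A hp hA => ?_⟩
  obtain ⟨n, x, hx, hGx⟩ := exists_mem_of_realizes_low hG hp hA
  refine ⟨pointName n x, ?_, (n, x), hx, names_pointName n x⟩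
  exact Part.mem_bind_iff.2
    ⟨_, Part.mem_bind_iff.2 ⟨_, Part.mem_some _, hGx⟩, Part.mem_some _⟩

theorem reducible_closedChoice_low :
    Reducible (closedChoice (prodRep natRep cantorRep)) low := by
  refine ⟨_, _, isComputable_snd, isComputable_lowSeq, fun G hG p A hp hA => ?_⟩
  obtain ⟨n, x, hx, hGx⟩ := exists_mem_of_realizes_low hG hp hA
  refine ⟨pointName n x, ?_, (n, x), hx, names_pointName n x⟩
  refine Part.mem_bind_iff.2 ⟨_, Part.mem_bind_iff.2 ⟨_, Part.mem_some _, hGx⟩, ?_⟩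
  rw [pair_odd]
  exact Part.mem_some _

/-! ### A low sequence that is not computable -/

open Classical in
/-- A program which, with oracle `⟨n, x⟩`, gives the answer `0` if `x` agrees somewhere with the
diagonal of the partial computable functions. -/
noncomputable def diagonalProgram : Baire := fun N =>
  -- The bit `x e` sits at position `2 * e + 1` of the pairing. The `isSome` conjunct excludes the
  -- spurious match `none = none`, and the output `1` encodes the answer `0`.
  if ∃ e < (Denumerable.ofNat (List ℕ) N.unpair.2).length,
    (Denumerable.ofNat (List ℕ) N.unpair.2)[2 * e + 1]?.isSome = true ∧
    (Denumerable.ofNat (List ℕ) N.unpair.2)[2 * e + 1]? =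
      (Denumerable.ofNat Nat.Partrec.Code e).evaln
        (Denumerable.ofNat (List ℕ) N.unpair.2).length e
  then 1 else 0

theorem computable_diagonalProgram : Computable diagonalProgram := by
  classical
  have hL : Primrec fun N : ℕ => Denumerable.ofNat (List ℕ) N.unpair.2 :=
    (Primrec.ofNat _).comp (Primrec.snd.comp .unpair)
  have hi : Primrec fun b : ℕ × ℕ => (Denumerable.ofNat (List ℕ) b.1.unpair.2)[2 * b.2 + 1]? :=
    Primrec.list_getElem?.comp (hL.comp .fst)
      (Primrec.succ.comp (Primrec.nat_mul.comp (.const 2) .snd))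
  have hR : PrimrecRel fun N e : ℕ =>
      (Denumerable.ofNat (List ℕ) N.unpair.2)[2 * e + 1]?.isSome = true ∧
      (Denumerable.ofNat (List ℕ) N.unpair.2)[2 * e + 1]? =
        (Denumerable.ofNat Nat.Partrec.Code e).evaln
          (Denumerable.ofNat (List ℕ) N.unpair.2).length e :=
    PrimrecPred.and (Primrec.eq.comp (Primrec.option_isSome.comp hi) (.const true))
      (Primrec.eq.comp hi (Nat.Partrec.Code.primrec_evaln.comp
        (((Primrec.list_length.comp (hL.comp .fst)).pair ((Primrec.ofNat _).comp .snd)).pair .snd)))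
  exact (Primrec.ite (primrecPred_exists_lt (Primrec.list_length.comp hL) hR)
    (.const 1) (.const 0)).to_comp

/-- Where nothing agrees with the diagonal, the program has no value at all, so it is not a name of
a closed set. The low basis argument only asks whether the answer `0` occurs. -/
theorem zero_mem_evalAt_diagonalProgram {p : Baire} {m : ℕ} : 0 ∈ evalAt diagonalProgram p m ↔
    ∃ e, p (2 * e + 1) ∈ (Denumerable.ofNat Nat.Partrec.Code e).eval e := by
  classical
  have hval : ∀ k, diagonalProgram (Nat.pair m (prefixCode p k)) = if ∃ e, 2 * e + 1 < k ∧
      p (2 * e + 1) ∈ (Denumerable.ofNat Nat.Partrec.Code e).evaln k e then 1 else 0 := by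
    intro k
    have hdec : Denumerable.ofNat (List ℕ) (prefixCode p k) = initSeg p k :=
      Denumerable.ofNat_encode _
    unfold diagonalProgram
    simp only [Nat.unpair_pair, hdec, length_initSeg]
    refine if_congr (exists_congr fun e => ?_) rfl rfl
    constructor
    · rintro ⟨-, h1, h2⟩
      obtain ⟨v, hv⟩ := Option.isSome_iff_exists.1 h1
      obtain ⟨h3, rfl⟩ := initSeg_getElem?_eq_some.1 hv
      exact ⟨h3, h2.symm.trans hv⟩
    · rintro ⟨h1, h2⟩
      have h3 : (initSeg p k)[2 * e + 1]? = some (p (2 * e + 1)) :=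
        initSeg_getElem?_eq_some.2 ⟨h1, rfl⟩
      exact ⟨by omega, by rw [h3]; rfl, h3.trans (Eq.symm h2)⟩
  rw [mem_evalAt]
  simp only [hval]
  constructor
  · rintro ⟨k, h, -⟩
    by_contra hne
    rw [if_neg] at h
    · omega
    · rintro ⟨e, -, he⟩
      exact hne ⟨e, Nat.Partrec.Code.evaln_sound he⟩
  · rintro ⟨e, he⟩
    obtain ⟨s, hs⟩ := Nat.Partrec.Code.evaln_complete.1 he
    have hex : ∃ k, ∃ e, 2 * e + 1 < k ∧
        p (2 * e + 1) ∈ (Denumerable.ofNat Nat.Partrec.Code e).evaln k e :=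
      ⟨s + (2 * e + 2), e, by omega, Nat.Partrec.Code.evaln_mono (by omega) hs⟩
    exact ⟨Nat.find hex, if_pos (Nat.find_spec hex), fun l hl => if_neg (Nat.find_min hex hl)⟩

theorem exists_not_computable_jump_mem_limMap :
    ∃ q r : Baire, Computable q ∧ ¬ Computable r ∧ jump r ∈ limMap q := by
  classical
  have hne : ∃ n x, ∀ m, 0 ∉ evalAt diagonalProgram (pointName n x) m := by
    -- This bit is `1` exactly when the `e`-th partial function has value `0` at `e`, so it always
    -- differs from that value.
    refine ⟨0, fun e => decide (0 ∈ (Denumerable.ofNat Nat.Partrec.Code e).eval e), fun m hm => ?_⟩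
    obtain ⟨e, he⟩ := zero_mem_evalAt_diagonalProgram.1 hm
    rw [pointName, congrFun (pair_odd _ _) e] at he
    by_cases h : 0 ∈ (Denumerable.ofNat Nat.Partrec.Code e).eval e
    · have := Part.mem_unique he h
      simp [h] at this
    · simp [h] at he
  obtain ⟨n, x, hx, hj⟩ := exists_jump_mem_limMap_lowSeq hne
  refine ⟨_, _, computable_lowSeq computable_diagonalProgram, fun hc => ?_, hj⟩
  have hodd : Computable fun e => pointName n x (2 * e + 1) :=
    hc.comp (Primrec.succ.comp (Primrec.nat_mul.comp (.const 2) .id)).to_comp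
  obtain ⟨c, hcode⟩ := Nat.Partrec.Code.exists_code.1 (Partrec.nat_iff.1 hodd.partrec)
  -- A computable point would have its odd part computed by some code `c`, and would then meet the
  -- diagonal at the index of `c`.
  refine hx 0 (zero_mem_evalAt_diagonalProgram.2 ⟨Encodable.encode c, ?_⟩)
  rw [Denumerable.ofNat_encode, hcode]
  exact Part.mem_some _

/-! ### `low` is not reducible to closed choice -/

/-- The initial segment of `pair p q` determined by initial segments of `p` and `q`. -/
def interleave (Q W : List ℕ) : List ℕ :=
  (List.range Q.length).map fun j => if j % 2 = 0 then Q.getD (j / 2) 0 else W.getD (j / 2) 0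

theorem interleave_initSeg (p q : Baire) (s : ℕ) :
    interleave (initSeg p s) (initSeg q s) = initSeg (pair p q) s := by
  rw [interleave, length_initSeg]
  refine List.map_inj_left.2 fun j hj => ?_
  have h : j / 2 < s := (Nat.div_le_self j 2).trans_lt (List.mem_range.1 hj)
  rw [initSeg_getD h, initSeg_getD h, pair]

theorem primrec_interleave : Primrec₂ interleave := by
  refine Primrec.list_map (Primrec.list_range.comp (Primrec.list_length.comp .fst)) ?_
  have h2 : Primrec fun b : (List ℕ × List ℕ) × ℕ => b.2 / 2 :=
    Primrec.nat_div.comp .snd (.const 2)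
  exact Primrec.ite (Primrec.eq.comp (Primrec.nat_mod.comp .snd (.const 2)) (.const 0))
    ((Primrec.list_getD 0).comp (Primrec.fst.comp .fst) h2)
    ((Primrec.list_getD 0).comp (Primrec.snd.comp .fst) h2)

/-- Every point of `{n} × 2^ℕ` is either killed by `P` or makes the program `A`, with first oracle
`Q`, answer `v` on `m`. -/
def Forces (P A Q : List ℕ) (n m v : ℕ) : Prop :=
  ∀ i < 2 ^ P.length, Kills P (initSeg (pointName n i.testBit) P.length) ∨
    Answers A (interleave Q (initSeg (pointName n i.testBit) P.length)) m v

theorem primrecPred_forces (n : ℕ) :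
    PrimrecPred fun b : (List ℕ × List ℕ × List ℕ) × ℕ × ℕ =>
      Forces b.1.1 b.1.2.1 b.1.2.2 n b.2.1 b.2.2 := by
  have hP : Primrec fun b : (List ℕ × List ℕ × List ℕ) × ℕ × ℕ => b.1.1 := Primrec.fst.comp .fst
  refine primrecPred_forall_lt (primrec_two_pow.comp (Primrec.list_length.comp hP)) ?_
  have hW := primrec_initSeg_pointName
    (α := ((List ℕ × List ℕ × List ℕ) × ℕ × ℕ) × ℕ) (.const n) .snd
    (Primrec.list_length.comp (hP.comp .fst))
  refine PrimrecPred.or (primrecPred_kills (hP.comp .fst) hW) (primrecPred_answers ?_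
    (primrec_interleave.comp ?_ hW) ?_ ?_)
  · exact Primrec.fst.comp (Primrec.snd.comp (Primrec.fst.comp .fst))
  · exact Primrec.snd.comp (Primrec.snd.comp (Primrec.fst.comp .fst))
  · exact Primrec.fst.comp (Primrec.snd.comp .fst)
  · exact Primrec.snd.comp (Primrec.snd.comp .fst)

theorem forces_initSeg {p a q : Baire} {s n m v : ℕ} :
    Forces (initSeg p s) (initSeg a s) (initSeg q s) n m v ↔
      ∀ x, Kills (initSeg p s) (initSeg (pointName n x) s) ∨
        Answers (initSeg a s) (initSeg (pair q (pointName n x)) s) m v := by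
  simp only [Forces, length_initSeg, interleave_initSeg]
  refine ⟨fun h x => ?_, fun h i _ => h _⟩
  obtain ⟨i, hi, hx⟩ := exists_testBit_eq x s
  have := h i hi
  rwa [← interleave_initSeg, ← initSeg_pointName_congr hx, interleave_initSeg] at this

/-- A total search for a witness of a decidable predicate that determines the value `r m`. -/
theorem computable_of_search {r : ℕ → ℕ} {F : ℕ → ℕ → Bool} (hF : Computable₂ F)
    (hsound : ∀ m t, F m t = true → t.unpair.2 = r m) (hcomplete : ∀ m, ∃ t, F m t = true) :
    Computable r := by
  have hv : Primrec fun b : ℕ × ℕ => b.2.unpair.2 := Primrec.snd.comp (Primrec.unpair.comp .snd)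
  have hf : Partrec fun m => Nat.rfindOpt fun t => bif F m t then some t.unpair.2 else none :=
    Partrec.rfindOpt (Computable.cond hF (Computable.option_some.comp hv.to_comp)
      (Computable.const none)).to₂
  refine hf.of_eq fun m => Part.eq_some_iff.2 ?_
  obtain ⟨t, ht⟩ := hcomplete m
  have hdom : (Nat.rfindOpt fun t => bif F m t then some t.unpair.2 else none).Dom :=
    Nat.rfindOpt_dom.2 ⟨t, t.unpair.2, by simp [ht]⟩
  obtain ⟨v, hv⟩ := Part.dom_iff_mem.1 hdom
  obtain ⟨t', ht'⟩ := Nat.rfindOpt_spec hv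
  cases hFt : F m t'
  · simp [hFt] at ht'
  · have hvt : t'.unpair.2 = v := by simpa [hFt] using ht'
    rwa [← hsound m t' hFt, hvt]

/-- If a computable program computes the same `r` from all points of `{n} × 2^ℕ` in a non-empty
co-c.e. closed set, then `r` is computable. -/
theorem computable_of_forall_mem_eta {p a q r : Baire} {n : ℕ} (hp : Computable p)
    (ha : Computable a) (hq : Computable q)
    (hne : ∃ x, ∀ m, 0 ∉ evalAt p (pointName n x) m)
    (hr : ∀ x, (∀ m, 0 ∉ evalAt p (pointName n x) m) → r ∈ eta a (pair q (pointName n x))) :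
    Computable r := by
  obtain ⟨f, hf, hfF⟩ : ∃ f : (List ℕ × List ℕ × List ℕ) × ℕ × ℕ → Bool, Primrec f ∧
      ∀ b, f b = true ↔ Forces b.1.1 b.1.2.1 b.1.2.2 n b.2.1 b.2.2 := by
    obtain ⟨_, hf⟩ := primrecPred_forces n
    exact ⟨_, hf, fun b => decide_eq_true_iff⟩
  have hs : ∀ {u : Baire}, Computable u →
      Computable fun b : ℕ × ℕ => initSeg u b.2.unpair.1 := fun hu =>
    (computable_initSeg hu).comp (Primrec.fst.comp (Primrec.unpair.comp .snd)).to_comp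
  have hv : Primrec fun b : ℕ × ℕ => b.2.unpair.2 := Primrec.snd.comp (Primrec.unpair.comp .snd)
  refine computable_of_search (F := fun m t => f ((initSeg p t.unpair.1, initSeg a t.unpair.1,
    initSeg q t.unpair.1), m, t.unpair.2)) (hf.to_comp.comp
      (((hs hp).pair ((hs ha).pair (hs hq))).pair (Computable.fst.pair hv.to_comp))) ?_ ?_
  · intro m t h
    obtain ⟨x, hx⟩ := hne
    -- A point that is never killed must satisfy the second alternative, and from it the program can
    -- only produce `r m`.
    refine Part.mem_unique (mem_evalAt_iff_exists_answers.2 ⟨t.unpair.1, ?_⟩)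
      (mem_eta.1 (hr x hx) m)
    exact (forces_initSeg.1 ((hfF _).1 h) x).resolve_left fun hk =>
      not_exists.2 hx (exists_kills_iff.1 ⟨_, hk⟩)
  · intro m
    suffices ∃ s, ∀ x, Kills (initSeg p s) (initSeg (pointName n x) s) ∨
        Answers (initSeg a s) (initSeg (pair q (pointName n x)) s) m (r m) by
      obtain ⟨s, hs⟩ := this
      refine ⟨Nat.pair s (r m), (hfF _).2 ?_⟩
      simp only [Nat.unpair_pair]
      exact forces_initSeg.2 hs
    -- If no stage sufficed, compactness would give a point that is never killed and from which `r
    -- m` is never produced, against `hr`.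
    by_contra! hcon
    obtain ⟨x, hx⟩ := exists_forall_of_antitone (T := fun s x =>
      ¬ Kills (initSeg p s) (initSeg (pointName n x) s) ∧
        ¬ Answers (initSeg a s) (initSeg (pair q (pointName n x)) s) m (r m)) (by
        intro s x y hxy
        rw [← interleave_initSeg, ← interleave_initSeg, initSeg_pointName_congr hxy]
        exact id) (fun s x h => ⟨fun hk => h.1 (hk.mono s.le_succ),
          fun hk => h.2 (hk.mono s.le_succ)⟩) hcon
    have hmem := mem_eta.1 (hr x fun k hk => by
      obtain ⟨s, hs⟩ := exists_kills_iff.2 ⟨k, hk⟩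
      exact (hx s).1 hs) m
    obtain ⟨s, hs⟩ := mem_evalAt_iff_exists_answers.1 hmem
    exact (hx s).2 hs

/-- `s` is a name of a solution of the instance of `g` named by `p`. -/
def Problem.Solves (g : Problem) (p s : Baire) : Prop :=
  ∃ x, g.repX.Names p x ∧ ∃ y ∈ g.map x, g.repY.Names s y

/-- A choice of solutions is turned into a realizer whose domain consists exactly of the names of
solvable instances. -/
theorem realizes_of_solves {g : Problem} {σ : Baire → Baire}
    (hσ : ∀ p, (∃ s, g.Solves p s) → g.Solves p (σ p)) :
    Realizes (fun p => ⟨∃ s, g.Solves p s, fun _ => σ p⟩) g := by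
  rintro p x hpx ⟨y, hy⟩
  obtain ⟨s, hs⟩ := g.repY.surj y
  have hdom : ∃ s, g.Solves p s := ⟨s, x, hpx, y, hy, hs⟩
  obtain ⟨x', hpx', h⟩ := hσ p hdom
  obtain rfl := g.repX.unique _ _ _ hpx hpx'
  exact ⟨σ p, ⟨hdom, rfl⟩, h⟩

/-- Replaces quantification over realizers by quantification over solutions of the single instance
`p'`, which does not depend on the realizer. -/
theorem exists_solves_of_reducible {f g : Problem} {K H : Baire →. Baire}
    (h : ∀ G : Baire →. Baire, Realizes G g →
      Realizes (fun p => ((H p).bind G).bind fun r => K (pair p r)) f)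
    {p : Baire} {x : f.X} (hp : f.repX.Names p x) (hx : (f.map x).Nonempty) :
    ∃ p' ∈ H p, (∃ s, g.Solves p' s) ∧ ∀ s, g.Solves p' s →
      ∃ t ∈ K (pair p s), ∃ y ∈ f.map x, f.repY.Names t y := by
  classical
  have hex : ∀ p', ∃ s, (∃ s, g.Solves p' s) → g.Solves p' s := fun p' => by
    by_cases hs : ∃ s, g.Solves p' s
    · exact ⟨hs.choose, fun _ => hs.choose_spec⟩
    · exact ⟨p', fun h' => absurd h' hs⟩
  choose σ hσ using hex
  obtain ⟨p', hp', hdom⟩ : ∃ p' ∈ H p, ∃ s, g.Solves p' s := by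
    obtain ⟨t, ht, -⟩ := h _ (realizes_of_solves hσ) p x hp hx
    obtain ⟨s, hs, -⟩ := Part.mem_bind_iff.1 ht
    obtain ⟨p', hp', hs⟩ := Part.mem_bind_iff.1 hs
    exact ⟨p', hp', hs.fst⟩
  refine ⟨p', hp', hdom, fun s' hs' => ?_⟩
  -- Changing the choice at `p'` alone makes the realizer return the prescribed solution `s'` there.
  obtain ⟨t, ht, hty⟩ := h _ (realizes_of_solves (σ := Function.update σ p' s') fun u hu => by
    by_cases hup : u = p'
    · subst hup
      simpa using hs'
    · simpa [hup] using hσ u hu) p x hp hx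
  obtain ⟨s, hs, hts⟩ := Part.mem_bind_iff.1 ht
  obtain ⟨u, hu, hus⟩ := Part.mem_bind_iff.1 hs
  obtain rfl := Part.mem_unique hp' hu
  have hs' : s' = s := (Function.update_self p' s' σ).symm.trans hus.snd
  exact ⟨t, hs' ▸ hts, hty⟩

theorem not_reducible_low_closedChoice :
    ¬ Reducible low (closedChoice (prodRep natRep cantorRep)) := by
  rintro ⟨K, H, ⟨k, hk, hK⟩, ⟨h, hh, hH⟩, hred⟩
  obtain ⟨q, r, hq, hr, hj⟩ := exists_not_computable_jump_mem_limMap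
  -- The index `n` of a slice meeting `A` is fixed non-uniformly; this is harmless, as only the
  -- computability of the single sequence `r` is at stake.
  obtain ⟨p, hp, ⟨-, A, hA, ⟨n, x₀⟩, hx₀, -⟩, hsol⟩ :=
    exists_solves_of_reducible (f := low) hred (p := q) (x := q) rfl ⟨r, hj⟩
  have hmem := fun x => mem_iff_of_closedRep_names hA (names_pointName n x)
  refine hr (computable_of_forall_mem_eta (computable_of_mem_eta hh hq (hH q p hp)) hk hq
    ⟨x₀, (hmem x₀).1 hx₀⟩ fun x hx => ?_)
  obtain ⟨t, ht, y, hy, hty⟩ := hsol (pointName n x)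
    ⟨A, hA, (n, x), (hmem x).2 hx, names_pointName n x⟩
  have hty : t = y := hty
  obtain rfl : t = r := hty.trans (eq_of_jump_mem_limMap hy hj)
  exact hK _ _ ht

end Weihrauch

theorem mainTheorem9 :
    Weihrauch.StrongReducible
        (Weihrauch.closedChoice (Weihrauch.prodRep Weihrauch.natRep Weihrauch.cantorRep))
        Weihrauch.low ∧
      Weihrauch.Reducible
        (Weihrauch.closedChoice (Weihrauch.prodRep Weihrauch.natRep Weihrauch.cantorRep))
        Weihrauch.low ∧
      ¬ Weihrauch.Reducible Weihrauch.low
        (Weihrauch.closedChoice (Weihrauch.prodRep Weihrauch.natRep Weihrauch.cantorRep)) :=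
  ⟨Weihrauch.strongReducible_closedChoice_low, Weihrauch.reducible_closedChoice_low,
    Weihrauch.not_reducible_low_closedChoice⟩
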